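/- Let $\mathbb{T}^\infty=\{(z_1,z_2,\ldots): z_n\in\mathbb{T}\}$ be the countably infinite product of unit circles $\mathbb{T}=\{z\in\mathbb{C}:|z|=1\}$, equipped with its normalised Haar measure $m$ (the product of the normalised arc-length measures on the factors). For $f\in L^1(\mathbb{T}^\infty)$ and a finitely supported integer sequence $\nu=(\nu_1,\nu_2,\ldots)$ write $\hat f(\nu)=\int_{\mathbb{T}^\infty} f(z)\prod_n z_n^{-\nu_n}\,dm(z)$, and let $H^1(\mathbb{T}^\infty)$ be the space of all complex-valued $f\in L^1(\mathbb{T}^\infty)$ such that $\hat f(\nu)=0$ whenever $\nu_n<0$ for some $n$. If $f\in H^1(\mathbb{T}^\infty)$ is not the zero element (that is, $f$ does not vanish $m$-almost everywhere), then $\log|f|\in L^1(\mathbb{T}^\infty)$; in particular $f\neq 0$ $m$-almost everywhere. -/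

import Mathlib

open MeasureTheory

noncomputable section

namespace InfiniteTorus

/-- The normalised Haar measure `dθ₁ × dθ₂ × ⋯` on the infinite-dimensional torus
`𝕋^∞ = UnitAddTorus ℕ = ℕ → ℝ ⧸ ℤ`: the countable product of the normalised Haar measures
of the factors. The point `θ` stands for `(e^{2πiθ₀}, e^{2πiθ₁}, …)`. -/
def haar : Measure (UnitAddTorus ℕ) :=
  Measure.infinitePi fun _ : ℕ => (AddCircle.haarAddCircle : Measure UnitAddCircle)

instance : IsProbabilityMeasure haar := by
  unfold haar; infer_instance

/-- The character `θ ↦ ∏ₙ e^{2πi νₙ θₙ}` of `𝕋^∞` with the finitely supported frequency `ν`. -/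
def character (ν : ℕ →₀ ℤ) : C(UnitAddTorus ℕ, ℂ) where
  toFun θ := ∏ n ∈ ν.support, fourier (ν n) (θ n)
  continuous_toFun := by fun_prop

/-- The Fourier coefficient `∫ f(θ) e^{-2πi ν·θ} dθ`. -/
def fourierCoefficient (f : UnitAddTorus ℕ → ℂ) (ν : ℕ →₀ ℤ) : ℂ :=
  ∫ θ, f θ * character (-ν) θ ∂haar

lemma norm_character (ν : ℕ →₀ ℤ) (θ : UnitAddTorus ℕ) : ‖character ν θ‖ = 1 := by
  simp only [character, ContinuousMap.coe_mk, fourier_apply, norm_prod, Circle.norm_coe,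
    Finset.prod_const_one]

lemma integrable_mul_character {f : UnitAddTorus ℕ → ℂ} (hf : Integrable f haar) (ν : ℕ →₀ ℤ) :
    Integrable (fun θ => f θ * character ν θ) haar :=
  hf.mul_bdd (character ν).continuous.aestronglyMeasurable
    (Filter.Eventually.of_forall fun θ => (norm_character ν θ).le)

/-- The Hardy space `H^p(𝕋^∞)`, `1 ≤ p ≤ ∞`: the functions in `L^p(𝕋^∞)` whose Fourier
coefficients vanish at every frequency with a negative entry. -/
def hardySpace (p : ENNReal) [Fact (1 ≤ p)] : Submodule ℂ (Lp ℂ p haar) where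
  carrier := {f | ∀ ν : ℕ →₀ ℤ, (∃ n, ν n < 0) → fourierCoefficient f ν = 0}
  zero_mem' := fun ν _ => by
    have h : fourierCoefficient ((0 : Lp ℂ p haar) : UnitAddTorus ℕ → ℂ) ν
        = ∫ _θ : UnitAddTorus ℕ, (0 : ℂ) ∂haar := by
      refine integral_congr_ae ?_
      filter_upwards [Lp.coeFn_zero ℂ p haar] with θ hθ
      rw [hθ, Pi.zero_apply, zero_mul]
    simpa using h
  add_mem' := by
    intro f g hf hg ν hν
    have hfi := (Lp.memLp f).integrable (Fact.out : 1 ≤ p)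
    have hgi := (Lp.memLp g).integrable (Fact.out : 1 ≤ p)
    have h : fourierCoefficient ((f + g : Lp ℂ p haar) : UnitAddTorus ℕ → ℂ) ν
        = fourierCoefficient f ν + fourierCoefficient g ν := by
      unfold fourierCoefficient
      rw [← integral_add (integrable_mul_character hfi _) (integrable_mul_character hgi _)]
      refine integral_congr_ae ?_
      filter_upwards [Lp.coeFn_add f g] with θ hθ
      rw [hθ, Pi.add_apply, add_mul]
    rw [h, hf ν hν, hg ν hν, add_zero]
  smul_mem' := by
    intro c f hf ν hν
    have h : fourierCoefficient ((c • f : Lp ℂ p haar) : UnitAddTorus ℕ → ℂ) ν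
        = c * fourierCoefficient f ν := by
      unfold fourierCoefficient
      rw [← integral_const_mul]
      refine integral_congr_ae ?_
      filter_upwards [Lp.coeFn_smul c f] with θ hθ
      rw [hθ, Pi.smul_apply, smul_eq_mul, mul_assoc]
    rw [h, hf ν hν, mul_zero]

end InfiniteTorus

end

open Filter Topology

namespace InfiniteTorus

/-! This is the Helson–Lowdenslager argument. The frequencies of `f` have nonnegative entries, and
such sequences are well-ordered colexicographically, so there is a least `ν` with nonzero
coefficient (`exists_colex_min`). Then `g = f * character (-ν)` has nonzero mean and is orthogonal
to every conjugate of a positive character. For such `g`, Szegő's inequality `‖∫ g‖ * exp (-∫ u) ≤ ∫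
‖g‖ * exp (-u)` holds for bounded measurable real `u` (`norm_integral_mul_exp_le`). With `u` the
logarithm of `‖f‖` truncated to `[exp (-n), 1]`, the right side is at most `1 + ∫ ‖f‖`, so `∫ -u` is
bounded uniformly in `n`. Monotone convergence concludes
(`memLp_log_norm_of_integral_truncation_le`). -/

/-! ### Characters: mean values and uniform density. -/

lemma character_eq_prod (ν : ℕ →₀ ℤ) (θ : UnitAddTorus ℕ) :
    character ν θ = ν.prod fun n k => fourier k (θ n) := rfl

lemma character_zero : character 0 = 1 := by
  ext θ
  simp [character_eq_prod]

lemma character_add (ν μ : ℕ →₀ ℤ) : character (ν + μ) = character ν * character μ := by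
  ext θ
  simp only [character_eq_prod, ContinuousMap.mul_apply]
  exact Finsupp.prod_add_index' (fun _ => fourier_zero) fun _ _ _ => fourier_add

lemma character_neg (ν : ℕ →₀ ℤ) : character (-ν) = star (character ν) := by
  ext θ
  simp only [character_eq_prod, ContinuousMap.star_apply]
  rw [Finsupp.prod_neg_index (h := fun n k => (fourier k (θ n) : ℂ)) fun _ => fourier_zero]
  simp [Finsupp.prod, ← starRingEnd_apply, map_prod]

lemma character_single (n : ℕ) (θ : UnitAddTorus ℕ) :
    character (Finsupp.single n 1) θ = fourier 1 (θ n) := by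
  rw [character_eq_prod]
  exact Finsupp.prod_single_index (h := fun n k => (fourier k (θ n) : ℂ)) fourier_zero

/-- Only finitely many coordinates matter, so Fubini applies; a factor with nonzero frequency
changes sign under a half-period shift. -/
lemma integral_character {ν : ℕ →₀ ℤ} (hν : ν ≠ 0) : ∫ θ, character ν θ ∂haar = 0 := by
  have h1 : ∀ θ, character ν θ = ∏ i : ν.support, fourier (ν i) (ν.support.restrict θ i) := by
    intro θ
    exact (Finset.prod_coe_sort ν.support fun n => fourier (ν n) (θ n)).symm
  simp_rw [h1]
  have hc : Continuous fun x : ν.support → UnitAddCircle =>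
      ∏ i : ν.support, fourier (ν i) (x i) := by fun_prop
  have hmap := integral_map (μ := haar) (φ := (ν.support.restrict : UnitAddTorus ℕ → _))
    (Finset.measurable_restrict _).aemeasurable hc.aestronglyMeasurable
  rw [← hmap, haar, Measure.infinitePi_map_restrict,
    integral_fintype_prod_eq_prod (𝕜 := ℂ) (ι := ν.support) (E := fun _ => UnitAddCircle)
      (fun i x => fourier (ν i) x)]
  obtain ⟨n, hn⟩ := Finsupp.support_nonempty_iff.2 hν
  refine Finset.prod_eq_zero (Finset.mem_univ ⟨n, hn⟩) ?_
  exact integral_eq_zero_of_add_right_eq_neg (μ := AddCircle.haarAddCircle)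
    (fourier_add_half_inv_index (Finsupp.mem_support_iff.1 hn) zero_lt_one)

/-- The trigonometric polynomials form a star subalgebra of the continuous functions. -/
noncomputable def trigonometricPolynomials : StarSubalgebra ℂ C(UnitAddTorus ℕ, ℂ) where
  toSubalgebra := Algebra.adjoin ℂ (Set.range character)
  star_mem' := by
    change Algebra.adjoin ℂ (Set.range character) ≤ star (Algebra.adjoin ℂ (Set.range character))
    refine Algebra.adjoin_le ?_
    rintro _ ⟨ν, rfl⟩
    exact Algebra.subset_adjoin ⟨-ν, character_neg ν⟩

lemma trigonometricPolynomials_coe : trigonometricPolynomials.toSubalgebra.toSubmodule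
    = Submodule.span ℂ (Set.range character) := by
  refine Algebra.adjoin_eq_span_of_subset _ (.trans (fun x hx => ?_) Submodule.subset_span)
  refine Submonoid.closure_induction (fun _ => id) ⟨0, character_zero⟩ ?_ hx
  rintro _ _ _ _ ⟨ν, rfl⟩ ⟨μ, rfl⟩
  exact ⟨ν + μ, character_add ν μ⟩

lemma trigonometricPolynomials_separatesPoints :
    trigonometricPolynomials.SeparatesPoints := by
  intro x y hxy
  obtain ⟨n, hn⟩ := Function.ne_iff.1 hxy
  refine ⟨_, ⟨character (Finsupp.single n 1), Algebra.subset_adjoin ⟨_, rfl⟩, rfl⟩, ?_⟩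
  simp only [character_single, fourier_one]
  contrapose hn
  exact AddCircle.injective_toCircle one_ne_zero (Subtype.coe_injective hn)

/-- The linear span of the characters is uniformly dense. -/
lemma mem_closure_span_character (φ : C(UnitAddTorus ℕ, ℂ)) :
    φ ∈ closure (Submodule.span ℂ (Set.range character) : Set C(UnitAddTorus ℕ, ℂ)) := by
  have h := ContinuousMap.starSubalgebra_topologicalClosure_eq_top_of_separatesPoints _
    trigonometricPolynomials_separatesPoints
  have h' : φ ∈ trigonometricPolynomials.topologicalClosure := h ▸ StarSubalgebra.mem_top
  rw [← trigonometricPolynomials_coe]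
  exact h'

lemma exists_seq_span_character (φ : C(UnitAddTorus ℕ, ℂ)) :
    ∃ p : ℕ → C(UnitAddTorus ℕ, ℂ), (∀ n, p n ∈ Submodule.span ℂ (Set.range character)) ∧
      (∀ n θ, ‖p n θ‖ ≤ ‖φ‖ + 1) ∧ ∀ θ, Tendsto (fun n => p n θ) atTop (𝓝 (φ θ)) := by
  obtain ⟨p, hp, hlim⟩ := mem_closure_iff_seq_limit.1 (mem_closure_span_character φ)
  obtain ⟨N, hN⟩ := eventually_atTop.1
    (hlim.norm.eventually (gt_mem_nhds (lt_add_one ‖φ‖)))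
  -- Dropping the first `N` terms makes the bound hold for every index.
  refine ⟨fun n => p (n + N), fun n => hp _, fun n θ => ?_, fun θ => ?_⟩
  · exact ((p (n + N)).norm_coe_le_norm θ).trans (hN _ (Nat.le_add_left _ _)).le
  · exact ((continuous_eval_const θ).tendsto φ).comp
      (hlim.comp (tendsto_add_atTop_nat N))

/-! ### Bounded approximation and uniqueness of Fourier coefficients. -/

lemma tendsto_integral_mul_of_bounded {α 𝕜 : Type*} [MeasurableSpace α] {m : Measure α} [RCLike 𝕜]
    {g : α → 𝕜} (hg : Integrable g m) {F : ℕ → α → 𝕜} {F' : α → 𝕜} {C : ℝ}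
    (hF : ∀ n, AEStronglyMeasurable (F n) m) (hC : ∀ n x, ‖F n x‖ ≤ C)
    (hlim : ∀ᵐ x ∂m, Tendsto (fun n => F n x) atTop (𝓝 (F' x))) :
    Tendsto (fun n => ∫ x, g x * F n x ∂m) atTop (𝓝 (∫ x, g x * F' x ∂m)) := by
  refine tendsto_integral_of_dominated_convergence (fun x => ‖g x‖ * C)
    (fun n => hg.aestronglyMeasurable.mul (hF n)) (hg.norm.mul_const C) (fun n => ?_) ?_
  · refine Eventually.of_forall fun x => ?_
    rw [norm_mul]
    exact mul_le_mul_of_nonneg_left (hC n x) (norm_nonneg _)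
  · filter_upwards [hlim] with x hx using hx.const_mul _

/-- A bounded measurable function is an almost everywhere limit of continuous functions with the
same bound. -/
lemma exists_seq_continuous_tendsto_ae {u : UnitAddTorus ℕ → ℝ}
    (hu : AEStronglyMeasurable u haar) {C : ℝ} (hC : ∀ θ, |u θ| ≤ C) :
    ∃ φ : ℕ → C(UnitAddTorus ℕ, ℝ), (∀ n θ, |φ n θ| ≤ C) ∧
      ∀ᵐ θ ∂haar, Tendsto (fun n => φ n θ) atTop (𝓝 (u θ)) := by
  have hC0 : -C ≤ C := by linarith [(abs_nonneg _).trans (hC 0)]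
  have hui : MemLp u 1 haar := MemLp.of_bound hu C (Eventually.of_forall hC)
  have hε : ∀ n : ℕ, ENNReal.ofReal (1 / ((n : ℝ) + 1)) ≠ 0 := fun n =>
    (ENNReal.ofReal_pos.2 Nat.one_div_pos_of_nat).ne'
  choose ψ hψ _ using fun n : ℕ =>
    hui.exists_boundedContinuous_eLpNorm_sub_le ENNReal.one_ne_top (hε n)
  have hlim : Tendsto (fun n => eLpNorm (⇑(ψ n) - u) 1 haar) atTop (𝓝 0) := by
    refine tendsto_of_tendsto_of_tendsto_of_le_of_le tendsto_const_nhds ?_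
      (fun _ => zero_le) (fun n => (eLpNorm_sub_comm _ _ _ _).trans_le (hψ n))
    simpa using ENNReal.tendsto_ofReal (tendsto_one_div_add_atTop_nhds_zero_nat (𝕜 := ℝ))
  obtain ⟨ns, _, hns⟩ := (tendstoInMeasure_of_tendsto_eLpNorm one_ne_zero
    (fun n => (ψ n).continuous.aestronglyMeasurable) hu hlim).exists_seq_tendsto_ae
  -- Clamping to `[-C, C]` enforces the bound and leaves `u` unchanged.
  refine ⟨fun n => ⟨fun θ => max (-C) (min C (ψ (ns n) θ)), by fun_prop⟩, fun n θ => ?_, ?_⟩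
  · exact abs_le.2 ⟨le_max_left _ _, max_le hC0 (min_le_left _ _)⟩
  · filter_upwards [hns] with θ hθ
    have h : u θ = max (-C) (min C (u θ)) := by
      rw [min_eq_right (abs_le.1 (hC θ)).2, max_eq_right (abs_le.1 (hC θ)).1]
    rw [h]
    exact tendsto_const_nhds.max (tendsto_const_nhds.min hθ)

/-- An integrable function is determined by its Fourier coefficients. -/
lemma ae_eq_zero_of_fourierCoefficient_eq_zero {f : UnitAddTorus ℕ → ℂ} (hf : Integrable f haar)
    (h : ∀ ν, fourierCoefficient f ν = 0) : f =ᵐ[haar] 0 := by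
  have hspan : ∀ p ∈ Submodule.span ℂ (Set.range character), ∫ θ, f θ * p θ ∂haar = 0 := by
    intro p hp
    have hi : ∀ q : C(UnitAddTorus ℕ, ℂ), Integrable (fun θ => f θ * q θ) haar := fun q =>
      hf.mul_bdd q.continuous.aestronglyMeasurable (Eventually.of_forall q.norm_coe_le_norm)
    induction hp using Submodule.span_induction with
    | mem p hp =>
      obtain ⟨ν, rfl⟩ := hp
      simpa [fourierCoefficient] using h (-ν)
    | zero => simp
    | add p q _ _ hp hq =>
      simp only [ContinuousMap.add_apply, mul_add]
      rw [integral_add (hi p) (hi q), hp, hq, add_zero]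
    | smul c p _ hp =>
      simp only [ContinuousMap.smul_apply, smul_eq_mul, mul_left_comm _ c]
      rw [integral_const_mul, hp, mul_zero]
  have hcont : ∀ φ : C(UnitAddTorus ℕ, ℂ), ∫ θ, f θ * φ θ ∂haar = 0 := by
    intro φ
    obtain ⟨p, hp, hb, hlim⟩ := exists_seq_span_character φ
    have := tendsto_integral_mul_of_bounded hf
      (fun n => (p n).continuous.aestronglyMeasurable) hb (Eventually.of_forall hlim)
    simp only [hspan _ (hp _)] at this
    exact (tendsto_nhds_unique this tendsto_const_nhds)
  refine hf.ae_eq_zero_of_forall_setIntegral_eq_zero fun s hs _ => ?_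
  obtain ⟨φ, hb, hlim⟩ := exists_seq_continuous_tendsto_ae (C := 1)
    (u := s.indicator fun _ => 1) (aestronglyMeasurable_const.indicator hs) fun θ => by
      by_cases hθ : θ ∈ s <;> simp [hθ]
  have := tendsto_integral_mul_of_bounded hf (F := fun n θ => (φ n θ : ℂ))
    (F' := fun θ => ((s.indicator (fun _ => 1) θ : ℝ) : ℂ)) (C := 1)
    (fun n => Continuous.aestronglyMeasurable (by fun_prop)) (fun n θ => by simpa using hb n θ)
    (by filter_upwards [hlim] with θ hθ using (Complex.continuous_ofReal.tendsto _).comp hθ)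
  have h0 : ∀ n, ∫ θ, f θ * (φ n θ : ℂ) ∂haar = 0 := fun n =>
    hcont ⟨fun θ => (φ n θ : ℂ), by fun_prop⟩
  simp only [h0] at this
  rw [← integral_indicator hs, ← tendsto_nhds_unique this tendsto_const_nhds]
  congr 1 with θ
  by_cases hθ : θ ∈ s <;> simp [hθ]

/-! ### The colexicographic half-space of frequencies. -/

/-- The largest differing index must decide: lexicographically, the unit vectors form an infinite
descending chain. -/
lemma exists_colex_min {S : Set (ℕ →₀ ℤ)} (hS : S.Nonempty) (hpos : ∀ ν ∈ S, ∀ n, 0 ≤ ν n) :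
    ∃ ν ∈ S, ∀ μ : ℕ →₀ ℤ, 0 < toColex μ → ν - μ ∉ S := by
  let c : (ℕ →₀ ℕ) → (ℕ →₀ ℤ) := Finsupp.mapRange (fun n : ℕ => (n : ℤ)) rfl
  have hc : ∀ ν ∈ S, ∃ a, c a = ν := fun ν hν =>
    ⟨ν.mapRange Int.toNat rfl, by ext n; simp [c, hpos ν hν n]⟩
  obtain ⟨ν, hν⟩ := hS
  obtain ⟨a, rfl⟩ := hc ν hν
  have hT : {a : Colex (ℕ →₀ ℕ) | c (ofColex a) ∈ S}.Nonempty := ⟨toColex a, hν⟩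
  have wf : WellFounded ((· < ·) : Colex (ℕ →₀ ℕ) → Colex (ℕ →₀ ℕ) → Prop) := wellFounded_lt
  refine ⟨c (ofColex (wf.min _ hT)), wf.min_mem _ hT, fun μ hμ hmem => ?_⟩
  obtain ⟨b, hb⟩ := hc _ hmem
  refine wf.not_lt_min {a : Colex (ℕ →₀ ℕ) | c (ofColex a) ∈ S} (x := toColex b) ?_ ?_
  · simpa [hb] using hmem
  · obtain ⟨i, hi, hlt⟩ := Finsupp.Colex.lt_iff.1 hμ
    refine Finsupp.Colex.lt_iff.2 ⟨i, fun j hj => ?_, ?_⟩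
    · have h1 := DFunLike.congr_fun hb j
      have h2 := hi j hj
      simp [c] at h1 h2 ⊢
      omega
    · have h1 := DFunLike.congr_fun hb i
      simp [c] at h1 hlt ⊢
      omega

/-- The span of the characters with positive frequency in the colexicographic order. -/
noncomputable def positiveSpan : Submodule ℂ C(UnitAddTorus ℕ, ℂ) :=
  Submodule.span ℂ (character '' {μ | 0 < toColex μ})

lemma mul_mem_positiveSpan {p q : C(UnitAddTorus ℕ, ℂ)} (hp : p ∈ positiveSpan)
    (hq : q ∈ positiveSpan) : p * q ∈ positiveSpan := by
  have h := Submodule.mul_mem_mul hp hq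
  rw [positiveSpan, Submodule.span_mul_span] at h
  refine Submodule.span_mono ?_ h
  rintro _ ⟨_, ⟨ν, hν, rfl⟩, _, ⟨μ, hμ, rfl⟩, rfl⟩
  exact ⟨ν + μ, add_pos (a := toColex ν) (b := toColex μ) hν hμ, character_add ν μ⟩

lemma pow_mem_positiveSpan {q : C(UnitAddTorus ℕ, ℂ)} (hq : q ∈ positiveSpan) (n : ℕ) :
    q ^ (n + 1) ∈ positiveSpan := by
  induction n with
  | zero => simpa using hq
  | succ n ih => rw [pow_succ]; exact mul_mem_positiveSpan ih hq

/-! ### Szegő's inequality. -/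

lemma integral_mul_eq_zero_of_mem_positiveSpan {g : UnitAddTorus ℕ → ℂ} (hg : Integrable g haar)
    (h : ∀ μ : ℕ →₀ ℤ, 0 < toColex μ → ∫ θ, g θ * character μ θ ∂haar = 0)
    {q : C(UnitAddTorus ℕ, ℂ)} (hq : q ∈ positiveSpan) : ∫ θ, g θ * q θ ∂haar = 0 := by
  have hi : ∀ q : C(UnitAddTorus ℕ, ℂ), Integrable (fun θ => g θ * q θ) haar := fun q =>
    hg.mul_bdd q.continuous.aestronglyMeasurable (Eventually.of_forall q.norm_coe_le_norm)
  induction hq using Submodule.span_induction with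
  | mem p hp =>
    obtain ⟨μ, hμ, rfl⟩ := hp
    exact h μ hμ
  | zero => simp
  | add p q _ _ hp hq =>
    simp only [ContinuousMap.add_apply, mul_add]
    rw [integral_add (hi p) (hi q), hp, hq, add_zero]
  | smul c p _ hp =>
    simp only [ContinuousMap.smul_apply, smul_eq_mul, mul_left_comm _ c]
    rw [integral_const_mul, hp, mul_zero]

lemma integral_eq_zero_of_mem_positiveSpan {q : C(UnitAddTorus ℕ, ℂ)} (hq : q ∈ positiveSpan) :
    ∫ θ, q θ ∂haar = 0 := by
  have := integral_mul_eq_zero_of_mem_positiveSpan (g := fun _ => 1) (integrable_const _)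
    (fun μ hμ => by
      simp only [one_mul]
      refine integral_character ?_
      rintro rfl
      exact lt_irrefl _ hμ) hq
  simpa using this

/-- In the exponential series every power of `q` past the zeroth stays in `positiveSpan`, hence
integrates to zero against `g`. -/
lemma integral_mul_exp_of_mem_positiveSpan {g : UnitAddTorus ℕ → ℂ} (hg : Integrable g haar)
    (h : ∀ μ : ℕ →₀ ℤ, 0 < toColex μ → ∫ θ, g θ * character μ θ ∂haar = 0)
    {q : C(UnitAddTorus ℕ, ℂ)} (hq : q ∈ positiveSpan) :
    ∫ θ, g θ * Complex.exp (q θ) ∂haar = ∫ θ, g θ ∂haar := by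
  have hsum : HasSum (fun n : ℕ => ∫ θ, g θ * (q θ ^ n / n.factorial) ∂haar)
      (∫ θ, g θ * Complex.exp (q θ) ∂haar) := by
    refine hasSum_integral_of_dominated_convergence
      (fun n θ => ‖g θ‖ * (‖q‖ ^ n / n.factorial)) (fun n => ?_) (fun n => ?_) ?_ ?_ ?_
    · exact hg.aestronglyMeasurable.mul (Continuous.aestronglyMeasurable (by fun_prop))
    · refine Eventually.of_forall fun θ => ?_
      rw [norm_mul, norm_div, norm_pow, Complex.norm_natCast]
      gcongr
      exact q.norm_coe_le_norm θ
    · exact Eventually.of_forall fun θ => (Real.summable_pow_div_factorial _).mul_left _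
    · simp_rw [tsum_mul_left]
      exact hg.norm.mul_const _
    · refine Eventually.of_forall fun θ => HasSum.mul_left _ ?_
      rw [Complex.exp_eq_exp_ℂ]
      exact NormedSpace.expSeries_div_hasSum_exp (q θ)
  refine hsum.unique ?_
  convert hasSum_single (f := fun n : ℕ => ∫ θ, g θ * (q θ ^ n / n.factorial) ∂haar) 0 ?_ using 1
  · simp
  · intro n hn
    obtain ⟨n, rfl⟩ := Nat.exists_eq_succ_of_ne_zero hn
    have := integral_mul_eq_zero_of_mem_positiveSpan hg h (pow_mem_positiveSpan hq n)
    simp only [ContinuousMap.pow_apply] at this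
    simp_rw [Nat.succ_eq_add_one, ← mul_div_assoc]
    rw [integral_div, this, zero_div]

/-- The order is total, and conjugation turns a negative frequency positive without changing the
real part. -/
lemma exists_re_eq_re_positiveSpan {p : C(UnitAddTorus ℕ, ℂ)}
    (hp : p ∈ Submodule.span ℂ (Set.range character)) :
    ∃ q ∈ positiveSpan, ∃ c : ℝ, ∀ θ, (p θ).re = (q θ).re + c := by
  -- Real parts are not complex linear, so the scalar is carried through the induction.
  suffices H : ∀ a : ℂ, ∃ q ∈ positiveSpan, ∃ c : ℝ, ∀ θ, (a * p θ).re = (q θ).re + c by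
    simpa using H 1
  induction hp using Submodule.span_induction with
  | zero => exact fun _ => ⟨0, zero_mem _, 0, by simp⟩
  | add p₁ p₂ _ _ h₁ h₂ =>
    intro a
    obtain ⟨q₁, hq₁, c₁, h₁⟩ := h₁ a
    obtain ⟨q₂, hq₂, c₂, h₂⟩ := h₂ a
    refine ⟨q₁ + q₂, add_mem hq₁ hq₂, c₁ + c₂, fun θ => ?_⟩
    simp only [ContinuousMap.add_apply, mul_add, Complex.add_re, h₁, h₂]
    ring
  | smul b p _ h =>
    intro a
    simpa only [ContinuousMap.smul_apply, smul_eq_mul, mul_assoc] using h (a * b)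
  | mem p hp =>
    intro a
    obtain ⟨ν, rfl⟩ := hp
    rcases lt_trichotomy 0 (toColex ν) with hν | hν | hν
    · exact ⟨a • character ν, Submodule.smul_mem _ _ (Submodule.subset_span ⟨ν, hν, rfl⟩), 0,
        by simp⟩
    · obtain rfl : ν = 0 := hν.symm
      exact ⟨0, zero_mem _, a.re, by simp [character_zero]⟩
    · have hν' : 0 < toColex (-ν) := neg_pos.2 hν
      refine ⟨star a • character (-ν),
        Submodule.smul_mem _ _ (Submodule.subset_span ⟨-ν, hν', rfl⟩), 0, fun θ => ?_⟩
      simp [character_neg]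

/-- The Helson–Lowdenslager form of Szegő's inequality, for the exponent of a trigonometric
polynomial. -/
lemma norm_integral_mul_exp_le_of_mem_positiveSpan {g : UnitAddTorus ℕ → ℂ}
    (hg : Integrable g haar)
    (h : ∀ μ : ℕ →₀ ℤ, 0 < toColex μ → ∫ θ, g θ * character μ θ ∂haar = 0)
    {q : C(UnitAddTorus ℕ, ℂ)} (hq : q ∈ positiveSpan) (c : ℝ) :
    ‖∫ θ, g θ ∂haar‖ * Real.exp (-∫ θ, ((q θ).re + c) ∂haar)
      ≤ ∫ θ, ‖g θ‖ * Real.exp (-((q θ).re + c)) ∂haar := by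
  have hqi : Integrable q haar :=
    Integrable.of_bound q.continuous.aestronglyMeasurable ‖q‖
      (Eventually.of_forall q.norm_coe_le_norm)
  have hre : ∫ θ, ((q θ).re + c) ∂haar = c := by
    have h0 : ∫ θ, (q θ).re ∂haar = 0 := by
      have := integral_re hqi
      simp only [RCLike.re_eq_complex_re] at this
      rw [this, integral_eq_zero_of_mem_positiveSpan hq, Complex.zero_re]
    have hqr : Integrable (fun θ => (q θ).re) haar := hqi.re
    rw [integral_add hqr (integrable_const c), h0]
    simp
  -- `∫ g` becomes `∫ g * exp (-q)`, whose integrand has modulus `‖g‖ * exp (-re q)`.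
  rw [hre, ← integral_mul_exp_of_mem_positiveSpan hg h (neg_mem hq)]
  calc _ ≤ (∫ θ, ‖g θ‖ * Real.exp (-(q θ).re) ∂haar) * Real.exp (-c) := by
        gcongr
        refine (norm_integral_le_integral_norm _).trans_eq ?_
        simp [Complex.norm_exp]
    _ = _ := by
        rw [← integral_mul_const]
        simp_rw [neg_add, Real.exp_add, mul_assoc]

lemma norm_integral_mul_exp_le_of_tendsto {g : UnitAddTorus ℕ → ℂ} (hg : Integrable g haar)
    {u : UnitAddTorus ℕ → ℝ} {v : ℕ → UnitAddTorus ℕ → ℝ} {C : ℝ}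
    (hv : ∀ n, AEStronglyMeasurable (v n) haar) (hC : ∀ n θ, |v n θ| ≤ C)
    (hlim : ∀ᵐ θ ∂haar, Tendsto (fun n => v n θ) atTop (𝓝 (u θ)))
    (h : ∀ n, ‖∫ θ, g θ ∂haar‖ * Real.exp (-∫ θ, v n θ ∂haar)
      ≤ ∫ θ, ‖g θ‖ * Real.exp (-v n θ) ∂haar) :
    ‖∫ θ, g θ ∂haar‖ * Real.exp (-∫ θ, u θ ∂haar) ≤ ∫ θ, ‖g θ‖ * Real.exp (-u θ) ∂haar := by
  have h1 : Tendsto (fun n => ∫ θ, v n θ ∂haar) atTop (𝓝 (∫ θ, u θ ∂haar)) :=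
    tendsto_integral_of_dominated_convergence (fun _ => C) hv (integrable_const C)
      (fun n => Eventually.of_forall (hC n)) hlim
  have h2 : Tendsto (fun n => ∫ θ, ‖g θ‖ * Real.exp (-v n θ) ∂haar) atTop
      (𝓝 (∫ θ, ‖g θ‖ * Real.exp (-u θ) ∂haar)) := by
    refine tendsto_integral_mul_of_bounded hg.norm (C := Real.exp C)
      (fun n => Real.continuous_exp.comp_aestronglyMeasurable (hv n).neg) (fun n θ => ?_) ?_
    · rw [Real.norm_eq_abs, Real.abs_exp]
      exact Real.exp_le_exp.2 ((neg_le_abs _).trans (hC n θ))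
    · filter_upwards [hlim] with θ hθ using (Real.continuous_exp.tendsto _).comp hθ.neg
  exact le_of_tendsto_of_tendsto'
    (((Real.continuous_exp.tendsto _).comp h1.neg).const_mul _) h2 h

/-- The Helson–Lowdenslager form of Szegő's inequality. -/
lemma norm_integral_mul_exp_le {g : UnitAddTorus ℕ → ℂ} (hg : Integrable g haar)
    (h : ∀ μ : ℕ →₀ ℤ, 0 < toColex μ → ∫ θ, g θ * character μ θ ∂haar = 0)
    {u : UnitAddTorus ℕ → ℝ} (hu : AEStronglyMeasurable u haar) {C : ℝ} (hC : ∀ θ, |u θ| ≤ C) :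
    ‖∫ θ, g θ ∂haar‖ * Real.exp (-∫ θ, u θ ∂haar) ≤ ∫ θ, ‖g θ‖ * Real.exp (-u θ) ∂haar := by
  have hcont : ∀ φ : C(UnitAddTorus ℕ, ℝ), ‖∫ θ, g θ ∂haar‖ * Real.exp (-∫ θ, φ θ ∂haar)
      ≤ ∫ θ, ‖g θ‖ * Real.exp (-φ θ) ∂haar := by
    intro φ
    let φ' : C(UnitAddTorus ℕ, ℂ) := ⟨fun θ => (φ θ : ℂ), by fun_prop⟩
    obtain ⟨p, hp, hb, hlim⟩ := exists_seq_span_character φ'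
    refine norm_integral_mul_exp_le_of_tendsto hg (v := fun n θ => (p n θ).re)
      (fun n => Continuous.aestronglyMeasurable (by fun_prop))
      (fun n θ => (Complex.abs_re_le_norm _).trans (hb n θ))
      (Eventually.of_forall fun θ => (Complex.continuous_re.tendsto _).comp (hlim θ)) fun n => ?_
    obtain ⟨q, hq, c, hc⟩ := exists_re_eq_re_positiveSpan (hp n)
    simp only [hc]
    exact norm_integral_mul_exp_le_of_mem_positiveSpan hg h hq c
  obtain ⟨φ, hb, hlim⟩ := exists_seq_continuous_tendsto_ae hu hC
  exact norm_integral_mul_exp_le_of_tendsto hg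
    (fun n => (φ n).continuous.aestronglyMeasurable) hb hlim fun n => hcont (φ n)

/-! ### Truncated logarithms. -/

lemma abs_log_max_min_exp_le {x : ℝ} (n : ℕ) :
    |Real.log (max (min x 1) (Real.exp (-n)))| ≤ n := by
  have h1 : Real.exp (-n) ≤ 1 := Real.exp_le_one_iff.2 (by simp)
  have h2 : 0 < max (min x 1) (Real.exp (-n)) := lt_max_of_lt_right (Real.exp_pos _)
  rw [abs_le]
  refine ⟨(Real.le_log_iff_exp_le h2).2 (le_max_right _ _), ?_⟩
  exact (Real.log_nonpos h2.le (max_le (min_le_right _ _) h1)).trans n.cast_nonneg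

/-- The quotient of `x` by its truncation is at most `1` if `x ≤ 1` and at most `x` otherwise; the
bound does not depend on `t`. -/
lemma mul_exp_neg_log_max_min_le {x : ℝ} (hx : 0 ≤ x) (t : ℝ) :
    x * Real.exp (-Real.log (max (min x 1) (Real.exp t))) ≤ 1 + x := by
  have h2 : 0 < max (min x 1) (Real.exp t) := lt_max_of_lt_right (Real.exp_pos _)
  rw [Real.exp_neg, Real.exp_log h2, ← div_eq_mul_inv, div_le_iff₀ h2]
  have h3 : min x 1 ≤ max (min x 1) (Real.exp t) := le_max_left _ _
  rcases le_total x 1 with h | h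
  · rw [min_eq_left h] at h3 ⊢
    nlinarith
  · rw [min_eq_right h] at h3 ⊢
    nlinarith

/-- If `log |f|` has uniformly bounded truncated integrals, then it is integrable. -/
lemma memLp_log_norm_of_integral_truncation_le {α : Type*} [MeasurableSpace α] {m : Measure α}
    [IsFiniteMeasure m] {f : α → ℂ} (hf : Integrable f m) {R : ℝ}
    (h : ∀ n : ℕ, ∫ x, -Real.log (max (min ‖f x‖ 1) (Real.exp (-n))) ∂m ≤ R) :
    (∀ᵐ x ∂m, f x ≠ 0) ∧ MemLp (fun x => Real.log ‖f x‖) 1 m := by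
  let w : ℕ → α → ENNReal := fun n x =>
    ENNReal.ofReal (-Real.log (max (min ‖f x‖ 1) (Real.exp (-n))))
  have hmeas : ∀ n : ℕ, AEStronglyMeasurable
      (fun x => -Real.log (max (min ‖f x‖ 1) (Real.exp (-n)))) m := fun n =>
    (Real.measurable_log.comp_aemeasurable ((hf.aestronglyMeasurable.norm.aemeasurable.min
      aemeasurable_const).max aemeasurable_const)).neg.aestronglyMeasurable
  have hw : ∀ n, ∫⁻ x, w n x ∂m ≤ ENNReal.ofReal R := by
    intro n
    rw [← ofReal_integral_eq_lintegral_ofReal]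
    · exact ENNReal.ofReal_le_ofReal (h n)
    · exact Integrable.of_bound (hmeas n) n (Eventually.of_forall fun x => by
        rw [norm_neg]; exact abs_log_max_min_exp_le n)
    · refine Eventually.of_forall fun x => neg_nonneg.2 (Real.log_nonpos ?_ ?_)
      · exact (lt_max_of_lt_right (Real.exp_pos _)).le
      · exact max_le (min_le_right _ _) (Real.exp_le_one_iff.2 (by simp))
  have hmono : ∀ x, Monotone fun n => w n x := by
    intro x n k hnk
    refine ENNReal.ofReal_le_ofReal (neg_le_neg (Real.log_le_log ?_ ?_))
    · exact lt_max_of_lt_right (Real.exp_pos _)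
    · gcongr
  have hwm : ∀ n, AEMeasurable (w n) m := fun n => (hmeas n).aemeasurable.ennreal_ofReal
  have hsup : ∫⁻ x, ⨆ n, w n x ∂m ≠ ⊤ := by
    rw [lintegral_iSup' hwm (Eventually.of_forall hmono)]
    exact ((iSup_le hw).trans_lt ENNReal.ofReal_lt_top).ne
  -- At a zero of `f`, `w n x = n`, so the supremum is infinite there.
  have hne : ∀ᵐ x ∂m, f x ≠ 0 := by
    filter_upwards [ae_lt_top' (AEMeasurable.iSup hwm) hsup] with x hx h0
    refine hx.ne (ENNReal.eq_top_of_forall_nnreal_le fun r => ?_)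
    obtain ⟨n, hn⟩ := exists_nat_ge r
    refine le_iSup_of_le n ?_
    simp only [w, h0, norm_zero, zero_le_one, min_eq_left, max_eq_right (Real.exp_pos _).le,
      Real.log_exp, neg_neg, ENNReal.ofReal_natCast]
    exact_mod_cast hn
  refine ⟨hne, memLp_one_iff_integrable.2
    ⟨(Real.measurable_log.comp_aemeasurable
      hf.aestronglyMeasurable.norm.aemeasurable).aestronglyMeasurable, ?_⟩⟩
  -- The supremum of the `w n` controls the negative part of the logarithm, and `log t ≤ t` the
  -- positive part.
  have hle : ∀ᵐ x ∂m, ‖Real.log ‖f x‖‖ₑ ≤ ‖f x‖ₑ + ⨆ n, w n x := by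
    filter_upwards [hne] with x hx
    have hpos : 0 < ‖f x‖ := norm_pos_iff.2 hx
    rcases le_total ‖f x‖ 1 with h1 | h1
    · refine le_add_left ?_
      obtain ⟨n, hn⟩ := exists_nat_ge (-Real.log ‖f x‖)
      refine le_iSup_of_le n ?_
      have h2 : Real.exp (-n) ≤ ‖f x‖ := (Real.le_log_iff_exp_le hpos).1 (by linarith)
      simp only [w, min_eq_left h1, max_eq_left h2]
      rw [Real.enorm_eq_ofReal_abs, abs_of_nonpos (Real.log_nonpos hpos.le h1)]
    · refine le_add_right ?_
      rw [Real.enorm_eq_ofReal_abs, abs_of_nonneg (Real.log_nonneg h1), ← ofReal_norm]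
      exact ENNReal.ofReal_le_ofReal (Real.log_le_self hpos.le)
  refine (lintegral_mono_ae hle).trans_lt ?_
  rw [lintegral_add_left' hf.aestronglyMeasurable.enorm]
  exact ENNReal.add_lt_top.2 ⟨hf.hasFiniteIntegral, hsup.lt_top⟩

end InfiniteTorus

/-! ### Integrability of the logarithm. -/

theorem mainTheorem3 (f : Lp ℂ 1 InfiniteTorus.haar)
    (hf : f ∈ InfiniteTorus.hardySpace 1) (hf0 : f ≠ 0) :
    (∀ᵐ θ ∂InfiniteTorus.haar, f θ ≠ 0) ∧
      MemLp (fun θ => Real.log ‖f θ‖) 1 InfiniteTorus.haar := by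
  open InfiniteTorus in
  have hfi : Integrable f haar := memLp_one_iff_integrable.1 (Lp.memLp f)
  have hS : {ν | fourierCoefficient f ν ≠ 0}.Nonempty := by
    by_contra hS
    refine hf0 ((Lp.eq_zero_iff_ae_eq_zero).2
      (ae_eq_zero_of_fourierCoefficient_eq_zero hfi fun ν => ?_))
    by_contra hν
    exact hS ⟨ν, hν⟩
  obtain ⟨ν, hν, hmin⟩ := exists_colex_min hS fun μ hμ n => by
    by_contra! hn
    exact hμ (hf μ ⟨n, hn⟩)
  let g : UnitAddTorus ℕ → ℂ := fun θ => f θ * character (-ν) θ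
  have hg : Integrable g haar := integrable_mul_character hfi _
  have hgf : ∀ θ, ‖g θ‖ = ‖f θ‖ := fun θ => by simp [g, norm_character]
  -- This integral is the coefficient of `f` at `ν - μ`, which precedes `ν`.
  have hgμ : ∀ μ : ℕ →₀ ℤ, 0 < toColex μ → ∫ θ, g θ * character μ θ ∂haar = 0 := by
    intro μ hμ
    have h := hmin μ hμ
    simp only [Set.mem_ofPred_eq, not_not, fourierCoefficient, neg_sub'] at h
    rw [← h]
    simp only [g, sub_neg_eq_add, character_add, ContinuousMap.mul_apply, mul_assoc]
  have hA : 0 < ‖∫ θ, g θ ∂haar‖ := norm_pos_iff.2 hν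
  refine memLp_log_norm_of_integral_truncation_le hfi
    (R := Real.log ((1 + ∫ θ, ‖f θ‖ ∂haar) / ‖∫ θ, g θ ∂haar‖)) fun n => ?_
  have hmeas : AEStronglyMeasurable
      (fun θ => Real.log (max (min ‖f θ‖ 1) (Real.exp (-n)))) haar :=
    (Real.measurable_log.comp_aemeasurable ((hfi.aestronglyMeasurable.norm.aemeasurable.min
      aemeasurable_const).max aemeasurable_const)).aestronglyMeasurable
  have key := norm_integral_mul_exp_le hg hgμ hmeas fun θ => abs_log_max_min_exp_le n
  have hK : ∫ θ, ‖g θ‖ * Real.exp (-Real.log (max (min ‖f θ‖ 1) (Real.exp (-n)))) ∂haar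
      ≤ 1 + ∫ θ, ‖f θ‖ ∂haar := by
    have h1 : ∫ θ, (1 + ‖f θ‖) ∂haar = 1 + ∫ θ, ‖f θ‖ ∂haar := by
      rw [integral_add (integrable_const _) hfi.norm]
      simp
    rw [← h1]
    refine integral_mono_of_nonneg (Eventually.of_forall fun θ => by positivity)
      ((integrable_const _).add hfi.norm) (Eventually.of_forall fun θ => ?_)
    simp only [hgf]
    exact mul_exp_neg_log_max_min_le (norm_nonneg _) _
  rw [integral_neg, Real.le_log_iff_exp_le (div_pos (by positivity) hA), le_div_iff₀ hA, mul_comm]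
  exact key.trans hK
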